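/- Let $m_1,m_2,n_1,n_2$ be smooth real functions of $x\in\mathbb R$, $u=(m_1,m_2,n_1,n_2)^T$, $\partial=d/dx$, and put $$P=(m_1,m_2,-n_1,-n_2)^T,\qquad S=(-n_2,n_1,-m_2,m_1)^T,\qquad \mathcal L=\mathcal J+\mathcal F,$$ $$\mathcal F=(2P+S\partial)(\partial^3-4\partial)^{-1}P^T-(2S+P\partial)(\partial^3-4\partial)^{-1}S^T,$$ $$\mathcal J=\begin{pmatrix}2m_1\partial^{-1}m_1&-m_1\partial^{-1}m_2&\mathcal J_{13}&\mathcal J_{14}\\-m_2\partial^{-1}m_1&2m_2\partial^{-1}m_2&\mathcal J_{23}&\mathcal J_{24}\\-\mathcal J_{13}^*&-\mathcal J_{23}^*&2n_1\partial^{-1}n_1&-n_1\partial^{-1}n_2\\-\mathcal J_{14}^*&-\mathcal J_{24}^*&-n_2\partial^{-1}n_1&2n_2\partial^{-1}n_2\end{pmatrix},$$ $$\mathcal J_{13}=-2m_1\partial^{-1}n_1-n_2\partial^{-1}m_2,\quad \mathcal J_{14}=m_1\partial^{-1}n_2+n_2\partial^{-1}m_1,\quad \mathcal J_{23}=m_2\partial^{-1}n_1+n_1\partial^{-1}m_2,\quad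 \mathcal J_{24}=-2m_2\partial^{-1}n_2-n_1\partial^{-1}m_1,$$ $$\mathcal K=\begin{pmatrix}0&-1&\partial&0\\1&0&0&\partial\\\partial&0&0&1\\0&\partial&-1&0\end{pmatrix}.$$ Here $\partial^{-1}f$ denotes an antiderivative of $f$, determined only up to a constant, and $(\partial^3-4\partial)^{-1}=(\partial^2-4)^{-1}\partial^{-1}$. For a smooth $\theta=(A,B,C,D)^T$, the equation $\mathcal L\theta=0$ means that it holds for some choice of the antiderivatives $\partial^{-1}(u_i\theta_j)$ (one choice for each product $u_i\theta_j$, used at all its occurrences in $\mathcal J$ and in $\mathcal F$) and of smooth solutions $q,r$ of $(\partial^2-4)q=\partial^{-1}P^T\theta$, $(\partial^2-4)r=\partial^{-1}S^T\theta$. Then: 1. (Kernel.) Suppose that $m_1$, $m_2$ and $m_1n_1+m_2n_2$ vanish nowhere. A smooth $(A,B,C,D)^T$ satisfies $\mathcal L(A,B,C,D)^T=0$ if and only if there are a number $k\in\mathbb R$ and a smooth function $\Gamma$ with $$A=-n_1\Gamma+\frac{n_1}{m_1m_2}K_3+\frac1{m_1}K_1,\quad B=-n_2\Gamma+\frac1{m_2}K_2,\quad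 C=-m_1\Gamma+\frac1{m_2}K_3,\quad D=-m_2\Gamma,$$ where, with $\Lambda=\dfrac{k}{m_1n_1+m_2n_2}$, $$K_1=(m_2n_2\Lambda)_x+(n_1n_2-m_1m_2)\Lambda,\qquad K_2=-(m_1n_1\Lambda)_x+(n_1n_2-m_1m_2)\Lambda,$$ $$K_3=(m_1m_2\Lambda)_x+(m_1n_1-m_2n_2)\Lambda,\qquad K_4=-(n_1n_2\Lambda)_x+(m_1n_1-m_2n_2)\Lambda.$$ For all $k$ and $\Gamma$ these functions satisfy $K_1=m_1A-n_1C$, $K_2=m_2B-n_2D$, $K_3=m_2C-m_1D$, $K_4=n_2A-n_1B$. 2. (Degeneracy.) For every smooth $u\neq0$ the operator $\mathcal L$ is degenerate: there is a nonzero operator $T:\Gamma\mapsto(\Gamma c_1,\dots,\Gamma c_4)^T$ with smooth coefficients $c_i$ such that $\mathcal L\,T\Gamma=0$ for every smooth $\Gamma$. 3. (Casimir.) Let $\Gamma=m_1n_1+m_2n_2$ and $H_c=-\frac12\int_{\mathbb R}\Gamma^2\,dx$, on the smooth $u$ for which this integral converges. The variational derivative of $H_c$ at such a $u$ (with respect to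 smooth compactly supported variations) exists, and is the vector $(A,B,C,D)^T=(-n_1\Gamma,-n_2\Gamma,-m_1\Gamma,-m_2\Gamma)^T$ that the formulas in part 1 give for $k=0$ and this $\Gamma$; it satisfies $\mathcal L\,\frac{\delta H_c}{\delta u}=0$, that is, $H_c$ is a Casimir of $\mathcal L$. 4. (Hamiltonian flow.) $\mathcal K$ is a Hamiltonian operator (skew-adjoint, with the Jacobi identity). For $\Gamma=m_1n_1+m_2n_2$ and $u(t,\cdot)$ in the domain of $H_c$ for $t$ in an open set of times, the system $$m_{1t}+(\Gamma m_1)_x-n_2\Gamma=0,\quad m_{2t}+(\Gamma m_2)_x+n_1\Gamma=0,\quad n_{1t}+(\Gamma n_1)_x+m_2\Gamma=0,\quad n_{2t}+(\Gamma n_2)_x-m_1\Gamma=0$$ is the Hamiltonian system $u_t=\mathcal K\,\dfrac{\delta H_c}{\delta u}$. -/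

import Mathlib

open scoped ContDiff
open MeasureTheory

/-- Four real functions on the line. A field configuration is `u = (m₁, m₂, n₁, n₂)`, so
`u 0 = m₁`, `u 1 = m₂`, `u 2 = n₁`, `u 3 = n₂`; a covector is `θ = (A, B, C, D)`. -/
abbrev Fields := Fin 4 → ℝ → ℝ

namespace Fields

/-- All four components are infinitely differentiable. -/
def Smooth (u : Fields) : Prop := ∀ i, ContDiff ℝ ∞ (u i)

/-- All four components have compact support. -/
def CompactSupp (u : Fields) : Prop := ∀ i, HasCompactSupport (u i)

/-- `m₁ n₁ + m₂ n₂`. -/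
def s (u : Fields) (x : ℝ) : ℝ := u 0 x * u 2 x + u 1 x * u 3 x

/-- The pairing `∫ ∑ᵢ φᵢ ψᵢ dx`. -/
noncomputable def pairing (φ ψ : Fields) : ℝ := ∫ x, ∑ i, φ i x * ψ i x

end Fields

/-! ### The nonlocal operator `L = J + F` -/

/-- The vector `P = (m₁, m₂, -n₁, -n₂)`. -/
def vecP (u : Fields) : Fields := ![u 0, u 1, -u 2, -u 3]

/-- The vector `S = (-n₂, n₁, -m₂, m₁)`. -/
def vecS (u : Fields) : Fields := ![-u 3, u 2, -u 1, u 0]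

/-- `J θ`, where `I i j` stands for the antiderivative `∂⁻¹(uᵢ θⱼ)`. The two lower left blocks are
the entries `-J₁₃*`, `-J₂₃*`, `-J₁₄*`, `-J₂₄*`, computed with `(f ∂⁻¹ g)* = -g ∂⁻¹ f`. -/
def applyJ (u : Fields) (I : Fin 4 → Fin 4 → ℝ → ℝ) : Fields :=
  ![fun x => 2 * u 0 x * I 0 0 x - u 0 x * I 1 1 x
      + (-2 * u 0 x * I 2 2 x - u 3 x * I 1 2 x) + (u 0 x * I 3 3 x + u 3 x * I 0 3 x),
    fun x => -u 1 x * I 0 0 x + 2 * u 1 x * I 1 1 x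
      + (u 1 x * I 2 2 x + u 2 x * I 1 2 x) + (-2 * u 1 x * I 3 3 x - u 2 x * I 0 3 x),
    fun x => -(2 * u 2 x * I 0 0 x + u 1 x * I 3 0 x) + (u 2 x * I 1 1 x + u 1 x * I 2 1 x)
      + 2 * u 2 x * I 2 2 x - u 2 x * I 3 3 x,
    fun x => (u 3 x * I 0 0 x + u 0 x * I 3 0 x) - (2 * u 3 x * I 1 1 x + u 0 x * I 2 1 x)
      - u 3 x * I 2 2 x + 2 * u 3 x * I 3 3 x]

/-- `F θ = (2P + S∂) q - (2S + P∂) r`, where `q` stands for `(∂³ - 4∂)⁻¹ Pᵀθ` and `r` for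
`(∂³ - 4∂)⁻¹ Sᵀθ`. -/
noncomputable def applyF (u : Fields) (q r : ℝ → ℝ) : Fields := fun i x =>
  (2 * vecP u i x * q x + vecS u i x * deriv q x)
    - (2 * vecS u i x * r x + vecP u i x * deriv r x)

/-- `w` is a value of `L θ`. The inverse `∂⁻¹` is only determined up to constants of integration,
so `L` is a linear relation: one antiderivative `I i j` is chosen for each product `uᵢ θⱼ`, the
same one wherever `∂⁻¹(uᵢ θⱼ)` occurs, and `(∂³ - 4∂)⁻¹` is `(∂² - 4)⁻¹ ∂⁻¹`
with this choice of `∂⁻¹`; thus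
`(∂² - 4) q = ∂⁻¹ (m₁A + m₂B - n₁C - n₂D)` and `(∂² - 4) r = ∂⁻¹ (-n₂A + n₁B - m₂C + m₁D)`. -/
def IsLValue (u θ w : Fields) : Prop :=
  ∃ (I : Fin 4 → Fin 4 → ℝ → ℝ) (q r : ℝ → ℝ),
    (∀ i j x, HasDerivAt (I i j) (u i x * θ j x) x) ∧
    ContDiff ℝ ∞ q ∧ ContDiff ℝ ∞ r ∧
    (∀ x, deriv (deriv q) x - 4 * q x = I 0 0 x + I 1 1 x - I 2 2 x - I 3 3 x) ∧
    (∀ x, deriv (deriv r) x - 4 * r x = -I 3 0 x + I 2 1 x - I 1 2 x + I 0 3 x) ∧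
    w = applyJ u I + applyF u q r

/-- The smooth covector `θ` satisfies `L θ = 0`. -/
def InKerL (u θ : Fields) : Prop := θ.Smooth ∧ IsLValue u θ 0

/-- `L` is degenerate at `u`: there is a nonzero differential operator `T : Γ ↦ Γ c` (of order
zero) with `L ∘ T = 0`. In particular `L` has a nonzero kernel. -/
def IsDegenerateL (u : Fields) : Prop :=
  ∃ c : Fields, c.Smooth ∧ c ≠ 0 ∧
    ∀ Γ : ℝ → ℝ, ContDiff ℝ ∞ Γ → InKerL u (fun i x => Γ x * c i x)

/-! ### The description of the kernel -/

/-- `K₁ = m₁A - n₁C`, `K₂ = m₂B - n₂D`, `K₃ = m₂C - m₁D`, `K₄ = n₂A - n₁B`. -/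
def combK (u θ : Fields) : Fields :=
  ![fun x => u 0 x * θ 0 x - u 2 x * θ 2 x,
    fun x => u 1 x * θ 1 x - u 3 x * θ 3 x,
    fun x => u 1 x * θ 2 x - u 0 x * θ 3 x,
    fun x => u 3 x * θ 0 x - u 2 x * θ 1 x]

/-- `Λ = k / (m₁ n₁ + m₂ n₂)`. -/
noncomputable def Lam (u : Fields) (k : ℝ) (x : ℝ) : ℝ := k / u.s x

/-- The expressions of `K₁, …, K₄` through `Λ`. -/
noncomputable def formK (u : Fields) (k : ℝ) : Fields :=
  ![fun x => deriv (fun y => u 1 y * u 3 y * Lam u k y) x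
      + (u 2 x * u 3 x - u 0 x * u 1 x) * Lam u k x,
    fun x => -deriv (fun y => u 0 y * u 2 y * Lam u k y) x
      + (u 2 x * u 3 x - u 0 x * u 1 x) * Lam u k x,
    fun x => deriv (fun y => u 0 y * u 1 y * Lam u k y) x
      + (u 0 x * u 2 x - u 1 x * u 3 x) * Lam u k x,
    fun x => -deriv (fun y => u 2 y * u 3 y * Lam u k y) x
      + (u 0 x * u 2 x - u 1 x * u 3 x) * Lam u k x]

/-- The covector `(A, B, C, D)` with number `k` and function `Γ`. -/
noncomputable def kerElem (u : Fields) (k : ℝ) (Γ : ℝ → ℝ) : Fields :=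
  ![fun x => -u 2 x * Γ x + u 2 x / (u 0 x * u 1 x) * formK u k 2 x + 1 / u 0 x * formK u k 0 x,
    fun x => -u 3 x * Γ x + 1 / u 1 x * formK u k 1 x,
    fun x => -u 0 x * Γ x + 1 / u 1 x * formK u k 2 x,
    fun x => -u 1 x * Γ x]

/-! ### Functionals, Hamiltonian operators and flows -/

/-- `G = (δH/δm₁, δH/δm₂, δH/δn₁, δH/δn₂)` at `u`: for all smooth compactly supported `η`,
the derivative of `H (u + ε η)` at `ε = 0` is `∫ ∑ᵢ Gᵢ ηᵢ dx`. -/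
def HasVariationalDeriv (H : Fields → ℝ) (u G : Fields) : Prop :=
  ∀ η : Fields, η.Smooth → η.CompactSupp →
    HasDerivAt (fun ε : ℝ => H (u + ε • η)) (G.pairing η) 0

/-- `H_c = -½ ∫ Γ² dx` with `Γ = m₁ n₁ + m₂ n₂`. -/
noncomputable def Hc (u : Fields) : ℝ := -(1 / 2) * ∫ x, (u.s x) ^ 2

/-- The smooth configurations for which the integral `H_c` converges. -/
def InDomHc (u : Fields) : Prop := u.Smooth ∧ Integrable (fun x => (u.s x) ^ 2)

/-- The operator `K`, with rows `(0, -1, ∂, 0)`, `(1, 0, 0, ∂)`, `(∂, 0, 0, 1)`, `(0, ∂, -1, 0)`. -/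
noncomputable def opK (θ : Fields) : Fields :=
  ![fun x => -θ 1 x + deriv (θ 2) x,
    fun x => θ 0 x + deriv (θ 3) x,
    fun x => deriv (θ 0) x + θ 3 x,
    fun x => deriv (θ 1) x - θ 2 x]

/-- The derivative of `v ↦ D(v) φ` at `u` in the direction `w`. -/
noncomputable def dirDeriv (D : Fields → Fields → Fields) (u w φ : Fields) : Fields := fun i x =>
  deriv (fun ε : ℝ => D (u + ε • w) φ i x) 0

/-- `D(u)` is a Hamiltonian operator: it is skew-adjoint, and
`∑_cyc ⟨φ₁, D'(u)[D(u) φ₂] φ₃⟩ = 0` (the Jacobi identity). -/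
def IsHamiltonianOp (D : Fields → Fields → Fields) : Prop :=
  ∀ u : Fields, u.Smooth →
    (∀ φ ψ : Fields, φ.Smooth → φ.CompactSupp → ψ.Smooth → ψ.CompactSupp →
      φ.pairing (D u ψ) = -ψ.pairing (D u φ)) ∧
    (∀ φ₁ φ₂ φ₃ : Fields, φ₁.Smooth → φ₁.CompactSupp → φ₂.Smooth → φ₂.CompactSupp →
      φ₃.Smooth → φ₃.CompactSupp →
      φ₁.pairing (dirDeriv D u (D u φ₂) φ₃) + φ₂.pairing (dirDeriv D u (D u φ₃) φ₁)
        + φ₃.pairing (dirDeriv D u (D u φ₁) φ₂) = 0)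

/-- `u` solves, for times in `T`, the flow
`m₁ₜ + (Γm₁)ₓ - n₂Γ = 0`, `m₂ₜ + (Γm₂)ₓ + n₁Γ = 0`,
`n₁ₜ + (Γn₁)ₓ + m₂Γ = 0`, `n₂ₜ + (Γn₂)ₓ - m₁Γ = 0`. -/
def SolvesPositiveFlow (T : Set ℝ) (Γ : ℝ → ℝ → ℝ) (u : ℝ → Fields) : Prop :=
  ∀ t ∈ T, ∀ x : ℝ,
    (∀ i, DifferentiableAt ℝ (fun τ => u τ i x) t) ∧
    deriv (fun τ => u τ 0 x) t + deriv (fun y => Γ t y * u t 0 y) x - u t 3 x * Γ t x = 0 ∧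
    deriv (fun τ => u τ 1 x) t + deriv (fun y => Γ t y * u t 1 y) x + u t 2 x * Γ t x = 0 ∧
    deriv (fun τ => u τ 2 x) t + deriv (fun y => Γ t y * u t 2 y) x + u t 1 x * Γ t x = 0 ∧
    deriv (fun τ => u τ 3 x) t + deriv (fun y => Γ t y * u t 3 y) x - u t 0 x * Γ t x = 0

/-- `u` solves, for times in `T`, the system `uₜ = D(u) δH/δu`. -/
def SolvesHamiltonianSystem (D : Fields → Fields → Fields) (H : Fields → ℝ) (T : Set ℝ)
    (u : ℝ → Fields) : Prop :=
  ∃ G : ℝ → Fields, ∀ t ∈ T, (G t).Smooth ∧ HasVariationalDeriv H (u t) (G t) ∧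
    ∀ i x, HasDerivAt (fun τ => u τ i x) (D (u t) (G t) i x) t

/-! The equation `L θ = 0` sees the antiderivatives only through potentials a, b, c, d of K₁, K₂,
K₃, K₄. Put α = 2a - b + 2q - r', β = 2b - a + 2q - r', γ = c + q' - 2r, δ = d + q' - 2r. Then `L θ
= 0` becomes m₁α = n₂γ, m₂β = -n₁γ, n₁α = -m₂δ, n₂β = m₁δ (`inKerL_iff`). Where m₁, m₂ and s = m₁n₁
+ m₂n₂ do not vanish, these say α = m₂n₂Λ, β = -m₁n₁Λ, γ = m₁m₂Λ, δ = -n₁n₂Λ for one function Λ, and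
sΛ = α - β = 3(a - b).

The crux is that a - b is constant (`KerPotentials.sub_const`). The function E = αβ - γδ + 3(a - b)²
has derivative αK₁ + βK₂ - γK₄ - δK₃, which vanishes on pairing the four equations with θ; they also
give αβ = γδ. So (a - b)² is constant, hence so is a - b, and Λ = k/s. Differentiating α, β, γ, δ
then yields the formulas for the Kᵢ, which determine θ up to Γ. Conversely, q and r are found from a
linear ODE system with constant coefficients (`exists_solution_coupled`), and a, b, c, d are read
off.

For k = 0 all Kᵢ vanish, so zero potentials work for every smooth u; this gives degeneracy and the
Casimir property. The functional `Hc` is a quartic polynomial along each line u + εη, and its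
gradient is unique by the fundamental lemma, which identifies the flow. -/

theorem hasDerivAt_deriv_of_smooth {f : ℝ → ℝ} (hf : ContDiff ℝ ∞ f) (x : ℝ) :
    HasDerivAt f (deriv f x) x :=
  ((hf.differentiable (by simp)) x).hasDerivAt

theorem smooth_deriv {f : ℝ → ℝ} (hf : ContDiff ℝ ∞ f) : ContDiff ℝ ∞ (deriv f) :=
  (contDiff_infty_iff_deriv.1 hf).2

theorem exists_antideriv {f : ℝ → ℝ} (hf : Continuous f) :
    ∃ F : ℝ → ℝ, ∀ x, HasDerivAt F (f x) x :=
  ⟨fun x => ∫ t in (0 : ℝ)..x, f t, fun x => (hf.integral_hasStrictDerivAt 0 x).hasDerivAt⟩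

theorem smooth_of_hasDerivAt {F f : ℝ → ℝ} (h : ∀ x, HasDerivAt F (f x) x)
    (hf : ContDiff ℝ ∞ f) : ContDiff ℝ ∞ F := by
  refine contDiff_infty_iff_deriv.2 ⟨fun x => (h x).differentiableAt, ?_⟩
  rwa [show deriv F = f from funext fun x => (h x).deriv]

/-! ### Reduction of the nonlocal equation to potentials. -/

/-- Potentials of the four combinations `K₁, …, K₄` that witness `L θ = 0`. -/
structure KerPotentials (u θ : Fields) (a b c d q r : ℝ → ℝ) : Prop where
  ha : ∀ x, HasDerivAt a (combK u θ 0 x) x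
  hb : ∀ x, HasDerivAt b (combK u θ 1 x) x
  hc : ∀ x, HasDerivAt c (combK u θ 2 x) x
  hd : ∀ x, HasDerivAt d (combK u θ 3 x) x
  hq : ContDiff ℝ ∞ q
  hr : ContDiff ℝ ∞ r
  hqq : ∀ x, deriv (deriv q) x - 4 * q x = a x + b x
  hrr : ∀ x, deriv (deriv r) x - 4 * r x = -(c x + d x)
  h0 : ∀ x, u 0 x * (2 * a x - b x + 2 * q x - deriv r x)
    = u 3 x * (c x + deriv q x - 2 * r x)
  h1 : ∀ x, u 1 x * (2 * b x - a x + 2 * q x - deriv r x)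
    = -u 2 x * (c x + deriv q x - 2 * r x)
  h2 : ∀ x, u 2 x * (2 * a x - b x + 2 * q x - deriv r x)
    = -u 1 x * (d x + deriv q x - 2 * r x)
  h3 : ∀ x, u 3 x * (2 * b x - a x + 2 * q x - deriv r x)
    = u 0 x * (d x + deriv q x - 2 * r x)

/-- The antiderivatives enter `applyJ` and the equations for q and r only through I₀₀ - I₂₂, I₁₁ -
I₃₃, I₁₂ - I₀₃ and I₃₀ - I₂₁, which are potentials of the Kᵢ. -/
theorem inKerL_iff {u : Fields} (hu : u.Smooth) (θ : Fields) :
    InKerL u θ ↔ θ.Smooth ∧ ∃ a b c d q r : ℝ → ℝ, KerPotentials u θ a b c d q r := by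
  refine and_congr_right fun hθ => ⟨?_, ?_⟩
  · rintro ⟨I, q, r, hI, hq, hr, hqq, hrr, hw⟩
    have e := fun i x => congrFun (congrFun hw i) x
    have e0 := e 0
    have e1 := e 1
    have e2 := e 2
    have e3 := e 3
    simp [applyJ, applyF, vecP, vecS] at e0 e1 e2 e3
    refine ⟨fun x => I 0 0 x - I 2 2 x, fun x => I 1 1 x - I 3 3 x,
      fun x => I 1 2 x - I 0 3 x, fun x => I 3 0 x - I 2 1 x, q, r,
      fun x => (hI 0 0 x).sub (hI 2 2 x), fun x => (hI 1 1 x).sub (hI 3 3 x),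
      fun x => (hI 1 2 x).sub (hI 0 3 x), fun x => (hI 3 0 x).sub (hI 2 1 x), hq, hr,
      fun x => ?_, fun x => ?_, fun x => ?_, fun x => ?_, fun x => ?_, fun x => ?_⟩
    · linear_combination hqq x
    · linear_combination hrr x
    · linear_combination -e0 x
    · linear_combination -e1 x
    · linear_combination e2 x
    · linear_combination e3 x
  · rintro ⟨a, b, c, d, q, r, h⟩
    have hA : ∀ i j, ∃ F : ℝ → ℝ, ∀ x, HasDerivAt F (u i x * θ j x) x := fun i j =>
      exists_antideriv ((hu i).continuous.mul (hθ j).continuous)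
    choose F hF using hA
    -- In each of the four differences one antiderivative is kept and the other is shifted, so that
    -- the difference is exactly the prescribed potential.
    refine ⟨fun i j => if i = 2 ∧ j = 2 then fun x => F 0 0 x - a x else
      if i = 3 ∧ j = 3 then fun x => F 1 1 x - b x else
      if i = 0 ∧ j = 3 then fun x => F 1 2 x - c x else
      if i = 2 ∧ j = 1 then fun x => F 3 0 x - d x else F i j,
      q, r, ?_, h.hq, h.hr, ?_, ?_, ?_⟩
    · intro i j x
      dsimp only
      split_ifs with h1 h2 h3 h4
      · rw [h1.1, h1.2]
        refine ((hF 0 0 x).sub (h.ha x)).congr_deriv ?_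
        simp [combK]
      · rw [h2.1, h2.2]
        refine ((hF 1 1 x).sub (h.hb x)).congr_deriv ?_
        simp [combK]
      · rw [h3.1, h3.2]
        refine ((hF 1 2 x).sub (h.hc x)).congr_deriv ?_
        simp [combK]
      · rw [h4.1, h4.2]
        refine ((hF 3 0 x).sub (h.hd x)).congr_deriv ?_
        simp [combK]
      · exact hF i j x
    · intro x
      simp
      linear_combination h.hqq x
    · intro x
      simp
      linear_combination h.hrr x
    · funext i x
      fin_cases i
      · simp [applyJ, applyF, vecP, vecS]
        linear_combination -h.h0 x
      · simp [applyJ, applyF, vecP, vecS]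
        linear_combination -h.h1 x
      · simp [applyJ, applyF, vecP, vecS]
        linear_combination h.h2 x
      · simp [applyJ, applyF, vecP, vecS]
        linear_combination h.h3 x

/-- A differentiable function whose square is constant is constant. -/
theorem const_of_sq_const {f f' : ℝ → ℝ} (hf : ∀ x, HasDerivAt f (f' x) x) {C : ℝ}
    (h : ∀ x, f x ^ 2 = C) : ∀ x, f x = f 0 := by
  rcases eq_or_ne C 0 with rfl | hC
  · intro x
    rw [pow_eq_zero_iff two_ne_zero |>.1 (h x), pow_eq_zero_iff two_ne_zero |>.1 (h 0)]
  · intro x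
    refine is_const_of_deriv_eq_zero (fun y => (hf y).differentiableAt) (fun y => ?_) x 0
    have h1 := (hf y).pow 2
    have h2 : HasDerivAt (f ^ 2) 0 y := by
      rw [show f ^ 2 = fun _ => C from funext h]
      exact hasDerivAt_const y C
    have h3 := h1.unique h2
    have h4 : f y ≠ 0 := fun h0 => hC (by rw [← h y, h0]; simp)
    rw [(hf y).deriv]
    simpa [h4] using h3

/-! ### The kernel when m₁, m₂ and m₁n₁ + m₂n₂ vanish nowhere. -/

section Kernel

variable {u θ : Fields} {a b c d q r : ℝ → ℝ}

/-- The difference of the first two potentials is constant. -/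
theorem KerPotentials.sub_const (h : KerPotentials u θ a b c d q r)
    (h0 : ∀ x, u 0 x ≠ 0) : ∀ x, a x - b x = a 0 - b 0 := by
  have hq1 : ∀ x, HasDerivAt (deriv q) (a x + b x + 4 * q x) x := fun x => by
    convert hasDerivAt_deriv_of_smooth (smooth_deriv h.hq) x using 1
    linear_combination -h.hqq x
  have hr1 : ∀ x, HasDerivAt (deriv r) (4 * r x - (c x + d x)) x := fun x => by
    convert hasDerivAt_deriv_of_smooth (smooth_deriv h.hr) x using 1
    linear_combination -h.hrr x
  have hq0 := hasDerivAt_deriv_of_smooth h.hq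
  have hr0 := hasDerivAt_deriv_of_smooth h.hr
  -- The first identity is the four equations paired with (A, B, -C, -D). The second follows from
  -- m₁αβ = n₂γβ = m₁γδ.
  have key : ∀ x, ((2 * a x - b x + 2 * q x - deriv r x) * combK u θ 0 x
      + (2 * b x - a x + 2 * q x - deriv r x) * combK u θ 1 x
      - (c x + deriv q x - 2 * r x) * combK u θ 3 x
      - (d x + deriv q x - 2 * r x) * combK u θ 2 x = 0) ∧
      (2 * a x - b x + 2 * q x - deriv r x) * (2 * b x - a x + 2 * q x - deriv r x)
        = (c x + deriv q x - 2 * r x) * (d x + deriv q x - 2 * r x) := fun x => by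
    have e0 := h.h0 x
    have e1 := h.h1 x
    have e2 := h.h2 x
    have e3 := h.h3 x
    have n0 := h0 x
    generalize 2 * a x - b x + 2 * q x - deriv r x = α at *
    generalize 2 * b x - a x + 2 * q x - deriv r x = β at *
    generalize c x + deriv q x - 2 * r x = γ at *
    generalize d x + deriv q x - 2 * r x = δ at *
    simp only [combK, Matrix.cons_val]
    constructor
    · linear_combination θ 0 x * e0 + θ 1 x * e1 - θ 2 x * e2 - θ 3 x * e3
    · apply mul_left_cancel₀ n0
      linear_combination β * e0 + γ * e3
  -- This is αβ - γδ + 3(a - b)² expanded, with q'² and r'² partly kept as products so that only q''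
  -- and r'' are needed for the derivative.
  let E : ℝ → ℝ := fun x => a x * a x - a x * b x + b x * b x - c x * d x
    + 2 * (q x * (a x + b x)) + 4 * (q x * q x) - deriv q x * deriv q x
    + deriv q x * (4 * r x - (c x + d x)) - deriv r x * (a x + b x + 4 * q x)
    + 2 * (r x * (c x + d x)) - 4 * (r x * r x) + deriv r x * deriv r x
  have hE : ∀ x, HasDerivAt E 0 x := fun x => by
    have A := h.ha x
    have B := h.hb x
    have C := h.hc x
    have D := h.hd x
    have Q := hq0 x
    have R := hr0 x
    have Q1 := hq1 x
    have R1 := hr1 x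
    refine HasDerivAt.congr_deriv ((((((((((((A.mul A).sub (A.mul B)).add (B.mul B)).sub (C.mul D)).add
      ((Q.mul (A.add B)).const_mul 2)).add ((Q.mul Q).const_mul 4)).sub (Q1.mul Q1)).add
      (Q1.mul ((R.const_mul 4).sub (C.add D)))).sub
      (R1.mul ((A.add B).add (Q.const_mul 4)))).add
      ((R.mul (C.add D)).const_mul 2)).sub ((R.mul R).const_mul 4)).add (R1.mul R1)) ?_
    simp only [Pi.add_apply, Pi.sub_apply]
    linear_combination (key x).1
  have hEc : ∀ x, E x = E 0 := fun x =>
    is_const_of_deriv_eq_zero (fun y => (hE y).differentiableAt) (fun y => (hE y).deriv) x 0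
  refine const_of_sq_const (f := fun x => a x - b x) (C := E 0 / 3)
    (fun x => (h.ha x).sub (h.hb x)) fun x => ?_
  rw [← hEc x]
  simp only [E]
  linear_combination -(1 / 3) * (key x).2

theorem smooth_s (hu : u.Smooth) : ContDiff ℝ ∞ u.s :=
  ((hu 0).mul (hu 2)).add ((hu 1).mul (hu 3))

theorem smooth_Lam (hu : u.Smooth) (hs : ∀ x, u.s x ≠ 0) (k : ℝ) : ContDiff ℝ ∞ (Lam u k) :=
  contDiff_const.div (smooth_s hu) hs

theorem smooth_formK (hu : u.Smooth) (hs : ∀ x, u.s x ≠ 0) (k : ℝ) : (formK u k).Smooth := by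
  have hL := smooth_Lam hu hs k
  have hd : ∀ i j, ContDiff ℝ ∞ (deriv fun y => u i y * u j y * Lam u k y) := fun i j =>
    smooth_deriv (((hu i).mul (hu j)).mul hL)
  have hm : ∀ i j i' j', ContDiff ℝ ∞ fun x => (u i x * u j x - u i' x * u j' x) * Lam u k x :=
    fun i j i' j' => (((hu i).mul (hu j)).sub ((hu i').mul (hu j'))).mul hL
  intro i
  fin_cases i
  · exact (hd 1 3).add (hm 2 3 0 1)
  · exact (hd 0 2).neg.add (hm 2 3 0 1)
  · exact (hd 0 1).add (hm 0 2 1 3)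
  · exact (hd 2 3).neg.add (hm 0 2 1 3)

theorem smooth_kerElem (hu : u.Smooth) (h0 : ∀ x, u 0 x ≠ 0) (h1 : ∀ x, u 1 x ≠ 0)
    (hs : ∀ x, u.s x ≠ 0) (k : ℝ) {Γ : ℝ → ℝ} (hΓ : ContDiff ℝ ∞ Γ) :
    (kerElem u k Γ).Smooth := by
  have hK := smooth_formK hu hs k
  intro i
  fin_cases i
  · exact (((hu 2).neg.mul hΓ).add (((hu 2).div ((hu 0).mul (hu 1))
      fun x => mul_ne_zero (h0 x) (h1 x)).mul (hK 2))).add ((contDiff_const.div (hu 0) h0).mul (hK 0))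
  · exact ((hu 3).neg.mul hΓ).add ((contDiff_const.div (hu 1) h1).mul (hK 1))
  · exact ((hu 0).neg.mul hΓ).add ((contDiff_const.div (hu 1) h1).mul (hK 2))
  · exact (hu 1).neg.mul hΓ

theorem s_mul_Lam (hs : ∀ x, u.s x ≠ 0) (k x : ℝ) : u.s x * Lam u k x = k := by
  rw [Lam, mul_div_cancel₀ _ (hs x)]

theorem deriv_mul_Lam (hu : u.Smooth) (hs : ∀ x, u.s x ≠ 0) (k : ℝ) (i j : Fin 4) (x : ℝ) :
    deriv (fun y => u i y * u j y * Lam u k y) x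
      = (deriv (u i) x * u j x + u i x * deriv (u j) x) * Lam u k x
        + u i x * u j x * deriv (Lam u k) x :=
  (((hasDerivAt_deriv_of_smooth (hu i) x).mul (hasDerivAt_deriv_of_smooth (hu j) x)).mul
    (hasDerivAt_deriv_of_smooth (smooth_Lam hu hs k) x)).deriv

theorem deriv_s_mul_Lam (hu : u.Smooth) (hs : ∀ x, u.s x ≠ 0) (k x : ℝ) :
    deriv (fun y => u 0 y * u 2 y * Lam u k y) x
      + deriv (fun y => u 1 y * u 3 y * Lam u k y) x = 0 := by
  have hL := smooth_Lam hu hs k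
  have e := (hasDerivAt_deriv_of_smooth (((hu 0).mul (hu 2)).mul hL) x).add
    (hasDerivAt_deriv_of_smooth (((hu 1).mul (hu 3)).mul hL) x)
  refine e.unique ((hasDerivAt_const x k).congr_of_eventuallyEq (.of_forall fun y => ?_))
  have h := s_mul_Lam hs k y
  simp only [Fields.s] at h
  simp only [Pi.add_apply]
  linear_combination h

/-- The formulas for A, B, C solve the definitions of K₁, K₂, K₃ with D = -m₂Γ left free. The
definition of K₄ is then a compatibility condition. -/
theorem combK_kerElem (hu : u.Smooth) (h0 : ∀ x, u 0 x ≠ 0) (h1 : ∀ x, u 1 x ≠ 0)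
    (hs : ∀ x, u.s x ≠ 0) (k : ℝ) (Γ : ℝ → ℝ) : combK u (kerElem u k Γ) = formK u k := by
  funext i x
  have n0 := h0 x
  have n1 := h1 x
  fin_cases i
  · simp only [combK, kerElem, Matrix.cons_val, Fin.zero_eta]
    field_simp
    ring
  · simp only [combK, kerElem, Matrix.cons_val, Fin.mk_one]
    field_simp
    ring
  · simp only [combK, kerElem, Matrix.cons_val, Fin.reduceFinMk]
    field_simp
    ring
  -- The linear relation m₁m₂K₄ = n₁n₂K₃ + m₂n₂K₁ - m₁n₁K₂ holds identically in θ; for the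
  -- expressions in Λ it holds because (sΛ)' = 0.
  · have key : u 0 x * u 1 x * formK u k 3 x = u 2 x * u 3 x * formK u k 2 x
        + u 1 x * u 3 x * formK u k 0 x - u 0 x * u 2 x * formK u k 1 x := by
      have e := deriv_s_mul_Lam hu hs k x
      simp only [formK, Matrix.cons_val]
      simp only [deriv_mul_Lam hu hs] at e ⊢
      linear_combination -(u 0 x * u 2 x + u 1 x * u 3 x) * e
    simp only [combK, kerElem, Matrix.cons_val, Fin.reduceFinMk]
    field_simp
    linear_combination -key

/-- Every kernel element is of the form `kerElem`. -/
theorem KerPotentials.exists_kerElem (hu : u.Smooth) (hθ : θ.Smooth) (h0 : ∀ x, u 0 x ≠ 0)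
    (h1 : ∀ x, u 1 x ≠ 0) (hs : ∀ x, u.s x ≠ 0) (h : KerPotentials u θ a b c d q r) :
    ∃ (k : ℝ) (Γ : ℝ → ℝ), ContDiff ℝ ∞ Γ ∧ θ = kerElem u k Γ := by
  have hab := h.sub_const h0
  -- The factor 3 comes from α - β = 3(a - b), which must equal sΛ = k.
  set k : ℝ := 3 * (a 0 - b 0) with hk
  have hq1 : ∀ x, HasDerivAt (deriv q) (a x + b x + 4 * q x) x := fun x => by
    convert hasDerivAt_deriv_of_smooth (smooth_deriv h.hq) x using 1
    linear_combination -h.hqq x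
  have hr1 : ∀ x, HasDerivAt (deriv r) (4 * r x - (c x + d x)) x := fun x => by
    convert hasDerivAt_deriv_of_smooth (smooth_deriv h.hr) x using 1
    linear_combination -h.hrr x
  have hq0 := hasDerivAt_deriv_of_smooth h.hq
  have hr0 := hasDerivAt_deriv_of_smooth h.hr
  have hK01 : ∀ x, combK u θ 0 x = combK u θ 1 x := fun x => by
    have e := (h.ha x).sub (h.hb x)
    rw [show a - b = fun _ => a 0 - b 0 from funext hab] at e
    exact sub_eq_zero.1 (e.unique (hasDerivAt_const x _))
  have hα : ∀ x, u 1 x * u 3 x * Lam u k x = 2 * a x - b x + 2 * q x - deriv r x := fun x => by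
    have e := hab x
    have e0 := h.h0 x
    have e1 := h.h1 x
    have n0 := h0 x
    rw [Lam, mul_div_assoc', div_eq_iff (hs x), hk, ← e]
    apply mul_left_cancel₀ n0
    simp only [Fields.s]
    linear_combination (-u 0 x * u 2 x) * e0 - u 0 x * u 3 x * e1
  have hβ : ∀ x, -(u 0 x * u 2 x * Lam u k x) = 2 * b x - a x + 2 * q x - deriv r x := fun x => by
    have e := s_mul_Lam hs k x
    simp only [Fields.s] at e
    linear_combination hα x - e + hk + 3 * hab x
  have hγ : ∀ x, u 0 x * u 1 x * Lam u k x = c x + deriv q x - 2 * r x := fun x => by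
    have e := s_mul_Lam hs k x
    apply mul_left_cancel₀ (hs x)
    simp only [Fields.s] at e ⊢
    linear_combination u 0 x * u 1 x * (e + hk - 3 * hab x) + u 1 x * h.h0 x - u 0 x * h.h1 x
  have hδ : ∀ x, -(u 2 x * u 3 x * Lam u k x) = d x + deriv q x - 2 * r x := fun x => by
    apply mul_left_cancel₀ (h0 x)
    linear_combination h.h3 x + u 3 x * hβ x
  -- Since K₁ = K₂, differentiation gives α' = K₁ + γ + δ, β' = K₂ + γ + δ, γ' = K₃ + α + β and δ' =
  -- K₄ + α + β.
  have hK : combK u θ = formK u k := by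
    funext i x
    fin_cases i
    · have e := (((((h.ha x).const_mul 2).sub (h.hb x)).add ((hq0 x).const_mul 2)).sub
        (hr1 x)).deriv
      have e' := (congrFun (congrArg deriv (funext hα)) x).trans e
      simp only [formK, Matrix.cons_val, Fin.zero_eta]
      linear_combination -e' - hK01 x + hγ x + hδ x
    · have e := (((((h.hb x).const_mul 2).sub (h.ha x)).add ((hq0 x).const_mul 2)).sub
        (hr1 x)).deriv
      have e' := (congrFun (congrArg deriv (funext hβ)) x).trans e
      rw [deriv.fun_neg] at e'
      simp only [formK, Matrix.cons_val, Fin.mk_one]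
      linear_combination -e' + hK01 x + hγ x + hδ x
    · have e := (((h.hc x).add (hq1 x)).sub ((hr0 x).const_mul 2)).deriv
      have e' := (congrFun (congrArg deriv (funext hγ)) x).trans e
      simp only [formK, Matrix.cons_val, Fin.reduceFinMk]
      linear_combination -e' + hα x + hβ x
    · have e := (((h.hd x).add (hq1 x)).sub ((hr0 x).const_mul 2)).deriv
      have e' := (congrFun (congrArg deriv (funext hδ)) x).trans e
      rw [deriv.fun_neg] at e'
      simp only [formK, Matrix.cons_val, Fin.reduceFinMk]
      linear_combination -e' + hα x + hβ x
  -- Γ is forced by D = -m₂Γ.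
  refine ⟨k, fun x => -θ 3 x / u 1 x, (hθ 3).neg.div (hu 1) h1, ?_⟩
  have hKx := fun i x => congrFun (congrFun hK i) x
  funext i x
  have n0 := h0 x
  have n1 := h1 x
  fin_cases i
  · simp only [kerElem, ← hKx, combK, Matrix.cons_val, Fin.zero_eta]
    field_simp
    ring
  · simp only [kerElem, ← hKx, combK, Matrix.cons_val, Fin.mk_one]
    field_simp
    ring
  · simp only [kerElem, ← hKx, combK, Matrix.cons_val, Fin.reduceFinMk]
    field_simp
    ring
  · simp only [kerElem, Matrix.cons_val, Fin.reduceFinMk]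
    field_simp

/-- The system `q'' - 2 r' = f`, `r'' - 2 q' = g` has smooth solutions. -/
theorem exists_solution_coupled {f g : ℝ → ℝ} (hf : ContDiff ℝ ∞ f) (hg : ContDiff ℝ ∞ g) :
    ∃ q r : ℝ → ℝ, ContDiff ℝ ∞ q ∧ ContDiff ℝ ∞ r ∧
      (∀ x, deriv (deriv q) x - 2 * deriv r x = f x) ∧
      (∀ x, deriv (deriv r) x - 2 * deriv q x = g x) := by
  have lin : ∀ (l : ℝ) (h : ℝ → ℝ), ContDiff ℝ ∞ h →
      ∃ y : ℝ → ℝ, ContDiff ℝ ∞ y ∧ ∀ x, HasDerivAt y (l * y x + h x) x := by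
    intro l h hh
    have hexp : ∀ m : ℝ, ContDiff ℝ ∞ fun x => Real.exp (m * x) := fun m =>
      (contDiff_const.mul contDiff_id).exp
    have hi : ContDiff ℝ ∞ fun x => Real.exp (-l * x) * h x := (hexp (-l)).mul hh
    obtain ⟨F, hF⟩ := exists_antideriv hi.continuous
    refine ⟨fun x => Real.exp (l * x) * F x, (hexp l).mul (smooth_of_hasDerivAt hF hi),
      fun x => ?_⟩
    have e1 : HasDerivAt (fun x => Real.exp (l * x)) (Real.exp (l * x) * (l * 1)) x :=
      ((hasDerivAt_id x).const_mul l).exp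
    refine (e1.mul (hF x)).congr_deriv ?_
    have e2 : Real.exp (l * x) * Real.exp (-l * x) = 1 := by
      rw [← Real.exp_add]
      simp
    linear_combination h x * e2
  -- The system decouples in y = q' + r' and z = q' - r': y' = 2y + f + g and z' = -2z + f - g.
  obtain ⟨y, hy, hy'⟩ := lin 2 _ (hf.add hg)
  obtain ⟨z, hz, hz'⟩ := lin (-2) _ (hf.sub hg)
  have hP : ContDiff ℝ ∞ fun x => (y x + z x) / 2 := (hy.add hz).div_const 2
  have hR : ContDiff ℝ ∞ fun x => (y x - z x) / 2 := (hy.sub hz).div_const 2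
  obtain ⟨q, hq⟩ := exists_antideriv hP.continuous
  obtain ⟨r, hr⟩ := exists_antideriv hR.continuous
  refine ⟨q, r, smooth_of_hasDerivAt hq hP, smooth_of_hasDerivAt hr hR, fun x => ?_, fun x => ?_⟩
  · rw [(hr x).deriv, show deriv q = _ from funext fun x => (hq x).deriv]
    have e := (((hy' x).add (hz' x)).div_const 2).deriv
    simp only [Pi.add_apply] at e
    linear_combination e
  · rw [(hq x).deriv, show deriv r = _ from funext fun x => (hr x).deriv]
    have e := (((hy' x).sub (hz' x)).div_const 2).deriv
    simp only [Pi.sub_apply] at e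
    linear_combination e

/-- With α, β, γ, δ prescribed through Λ, the equations for q and r become q'' - 2r' = α + β and r''
- 2q' = -(γ + δ). Inverting the definitions gives a = (2α + β)/3 - 2q + r', and similarly b, c, d.
-/
theorem exists_kerPotentials (hu : u.Smooth) (hs : ∀ x, u.s x ≠ 0) {k : ℝ}
    (hK : combK u θ = formK u k) : ∃ a b c d q r : ℝ → ℝ, KerPotentials u θ a b c d q r := by
  have hL := smooth_Lam hu hs k
  have hp : ∀ i j, ContDiff ℝ ∞ fun x => u i x * u j x * Lam u k x := fun i j =>
    ((hu i).mul (hu j)).mul hL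
  obtain ⟨q, r, hq, hr, e1, e2⟩ := exists_solution_coupled
    ((hp 1 3).sub (hp 0 2)) ((hp 2 3).sub (hp 0 1))
  have D := fun i j => hasDerivAt_deriv_of_smooth (hp i j)
  have hq0 := hasDerivAt_deriv_of_smooth hq
  have hr0 := hasDerivAt_deriv_of_smooth hr
  have hq1 := hasDerivAt_deriv_of_smooth (smooth_deriv hq)
  have hr1 := hasDerivAt_deriv_of_smooth (smooth_deriv hr)
  have hK' := fun i x => congrFun (congrFun hK i) x
  refine ⟨fun x => (2 * (u 1 x * u 3 x * Lam u k x) - u 0 x * u 2 x * Lam u k x) / 3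
      - 2 * q x + deriv r x,
    fun x => (u 1 x * u 3 x * Lam u k x - 2 * (u 0 x * u 2 x * Lam u k x)) / 3
      - 2 * q x + deriv r x,
    fun x => u 0 x * u 1 x * Lam u k x - deriv q x + 2 * r x,
    fun x => -(u 2 x * u 3 x * Lam u k x) - deriv q x + 2 * r x, q, r,
    fun x => ?_, fun x => ?_, fun x => ?_, fun x => ?_, hq, hr,
    fun x => ?_, fun x => ?_, fun x => ?_, fun x => ?_, fun x => ?_, fun x => ?_⟩
  · refine HasDerivAt.congr_deriv (((((((D 1 3 x).const_mul 2).sub (D 0 2 x)).div_const 3).sub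
      ((hq0 x).const_mul 2)).add (hr1 x))) ?_
    rw [hK']
    simp only [formK, Matrix.cons_val]
    linear_combination -(1 / 3) * deriv_s_mul_Lam hu hs k x + e2 x
  · refine HasDerivAt.congr_deriv ((((((D 1 3 x).sub ((D 0 2 x).const_mul 2)).div_const 3).sub
      ((hq0 x).const_mul 2)).add (hr1 x))) ?_
    rw [hK']
    simp only [formK, Matrix.cons_val]
    linear_combination (1 / 3) * deriv_s_mul_Lam hu hs k x + e2 x
  · refine HasDerivAt.congr_deriv (((D 0 1 x).sub (hq1 x)).add ((hr0 x).const_mul 2)) ?_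
    rw [hK']
    simp only [formK, Matrix.cons_val]
    linear_combination -e1 x
  · refine HasDerivAt.congr_deriv (((D 2 3 x).neg.sub (hq1 x)).add ((hr0 x).const_mul 2)) ?_
    rw [hK']
    simp only [formK, Matrix.cons_val]
    linear_combination -e1 x
  · linear_combination e1 x
  · linear_combination e2 x
  · ring
  · ring
  · ring
  · ring

end Kernel

/-! ### Degeneracy: the kernel elements with k = 0. -/

/-- If `K₁ = K₂ = K₃ = K₄ = 0`, then `L θ = 0`, with all constants of integration zero. -/
theorem inKerL_of_combK_eq_zero {u θ : Fields} (hu : u.Smooth) (hθ : θ.Smooth)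
    (h : combK u θ = 0) : InKerL u θ := by
  refine (inKerL_iff hu θ).2 ⟨hθ, 0, 0, 0, 0, 0, 0, ?_⟩
  have hz : deriv (0 : ℝ → ℝ) = 0 := by funext x; simp
  constructor <;> first
    | exact contDiff_const
    | (intro x; simp [h, hz])

/-- For k = 0 every quotient in `kerElem` is multiplied by zero, so no nonvanishing assumption on u
is needed. -/
theorem kerElem_zero (u : Fields) (Γ : ℝ → ℝ) :
    kerElem u 0 Γ = fun i x => Γ x * ![-u 2, -u 3, -u 0, -u 1] i x := by
  funext i x
  fin_cases i <;> simp [kerElem, formK, Lam, mul_comm]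

theorem smooth_gradHc {u : Fields} (hu : u.Smooth) :
    Fields.Smooth ![-u 2, -u 3, -u 0, -u 1] := by
  intro i
  fin_cases i
  · exact (hu 2).neg
  · exact (hu 3).neg
  · exact (hu 0).neg
  · exact (hu 1).neg

theorem smooth_kerElem_zero {u : Fields} (hu : u.Smooth) {Γ : ℝ → ℝ} (hΓ : ContDiff ℝ ∞ Γ) :
    (kerElem u 0 Γ).Smooth := by
  rw [kerElem_zero]
  exact fun i => hΓ.mul (smooth_gradHc hu i)

theorem inKerL_kerElem_zero {u : Fields} (hu : u.Smooth) {Γ : ℝ → ℝ} (hΓ : ContDiff ℝ ∞ Γ) :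
    InKerL u (kerElem u 0 Γ) := by
  refine inKerL_of_combK_eq_zero hu (smooth_kerElem_zero hu hΓ) ?_
  rw [kerElem_zero]
  funext i x
  fin_cases i <;> simp [combK] <;> ring

theorem isDegenerateL {u : Fields} (hu : u.Smooth) (h : u ≠ 0) : IsDegenerateL u := by
  refine ⟨![-u 2, -u 3, -u 0, -u 1], smooth_gradHc hu, fun h0 => h ?_, fun Γ hΓ => ?_⟩
  · have e := fun i => congrFun h0 i
    have e0 := e 0
    have e1 := e 1
    have e2 := e 2
    have e3 := e 3
    simp at e0 e1 e2 e3
    funext i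
    fin_cases i <;> simp [*]
  · rw [← kerElem_zero]
    exact inKerL_kerElem_zero hu hΓ

/-! ### The variational derivative of the Casimir. -/

theorem integrable_mul_of_compactSupp {f g : ℝ → ℝ} (hf : Continuous f) (hg : Continuous g)
    (h : HasCompactSupport g) : Integrable fun x => f x * g x :=
  (hf.mul hg).integrable_of_hasCompactSupport h.mul_left

/-- Fundamental lemma of the calculus of variations for `Fields`. -/
theorem Fields.eq_of_pairing_eq {G G' : Fields} (hG : G.Smooth) (hG' : G'.Smooth)
    (h : ∀ η : Fields, η.Smooth → η.CompactSupp → G.pairing η = G'.pairing η) : G = G' := by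
  funext i
  have hc : Continuous fun x => G i x - G' i x := (hG i).continuous.sub (hG' i).continuous
  have hae : ∀ᵐ x, G i x - G' i x = 0 := by
    refine ae_eq_zero_of_integral_contDiff_smul_eq_zero hc.locallyIntegrable fun g hg hgc => ?_
    have e := h (Pi.single i g) (fun j => ?_) fun j => ?_
    · have hp : ∀ F : Fields, F.pairing (Pi.single i g) = ∫ x, F i x * g x := fun F => by
        unfold Fields.pairing
        congr 1
        funext x
        rw [Finset.sum_eq_single i] <;> simp +contextual
      rw [hp, hp] at e
      have e1 := integrable_mul_of_compactSupp (hG i).continuous hg.continuous hgc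
      have e2 := integrable_mul_of_compactSupp (hG' i).continuous hg.continuous hgc
      rw [← sub_eq_zero, ← integral_sub e1 e2] at e
      rw [← e]
      congr 1
      funext x
      simp only [smul_eq_mul]
      ring
    · rcases eq_or_ne j i with rfl | hj
      · simpa using hg
      · rw [Pi.single_eq_of_ne hj]
        exact contDiff_const
    · rcases eq_or_ne j i with rfl | hj
      · simpa using hgc
      · simpa [hj] using HasCompactSupport.zero
  have := (Continuous.ae_eq_iff_eq volume hc continuous_const).1 hae
  funext x
  exact sub_eq_zero.1 (congrFun this x)

theorem Fields.s_add_smul (u η : Fields) (ε x : ℝ) :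
    (u + ε • η).s x = u.s x
      + ε * (u 2 x * η 0 x + u 3 x * η 1 x + u 0 x * η 2 x + u 1 x * η 3 x)
      + ε ^ 2 * η.s x := by
  simp only [Fields.s, Pi.add_apply, Pi.smul_apply, smul_eq_mul]
  ring

theorem hasVariationalDeriv_Hc {u : Fields} (hu : InDomHc u) :
    HasVariationalDeriv Hc u (kerElem u 0 u.s) := by
  intro η hη hηc
  obtain ⟨hu, hi⟩ := hu
  have cu := fun i => (hu i).continuous
  have cη := fun i => (hη i).continuous
  let v : ℝ → ℝ := fun x => u 2 x * η 0 x + u 3 x * η 1 x + u 0 x * η 2 x + u 1 x * η 3 x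
  have hv : Continuous v := by fun_prop
  have hvc : HasCompactSupport v :=
    (((hηc 0).mul_left.add (hηc 1).mul_left).add (hηc 2).mul_left).add (hηc 3).mul_left
  have hw : Continuous η.s := (smooth_s hη).continuous
  have hwc : HasCompactSupport η.s := (hηc 2).mul_left.add (hηc 3).mul_left
  have hs : Continuous u.s := (smooth_s hu).continuous
  have i1 := integrable_mul_of_compactSupp hs hv hvc
  have i2 := (integrable_mul_of_compactSupp hv hv hvc).add
    ((integrable_mul_of_compactSupp hs hw hwc).const_mul 2)
  have i3 := integrable_mul_of_compactSupp hv hw hwc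
  have i4 := integrable_mul_of_compactSupp hw hw hwc
  -- As s(u + εη) is quadratic in ε, its square is quartic. Every coefficient except that of ε⁰ has
  -- compact support, so convergence at u suffices and no differentiation under the integral is
  -- required.
  have hH : (fun ε : ℝ => Hc (u + ε • η)) = fun ε => -(1 / 2) * ((∫ x, u.s x ^ 2)
      + ε * (2 * ∫ x, u.s x * v x) + ε ^ 2 * (∫ x, v x * v x + 2 * (u.s x * η.s x))
      + ε ^ 3 * (2 * ∫ x, v x * η.s x) + ε ^ 4 * ∫ x, η.s x * η.s x) := by
    funext ε
    have e : (fun x => (u + ε • η).s x ^ 2) = fun x => u.s x ^ 2 + ε * (2 * (u.s x * v x))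
        + ε ^ 2 * (v x * v x + 2 * (u.s x * η.s x)) + ε ^ 3 * (2 * (v x * η.s x))
        + ε ^ 4 * (η.s x * η.s x) := by
      funext x
      rw [Fields.s_add_smul]
      simp only [v]
      ring
    have j1 := (i1.const_mul 2).const_mul ε
    have j2 : Integrable fun x => ε ^ 2 * (v x * v x + 2 * (u.s x * η.s x)) :=
      i2.const_mul (ε ^ 2)
    have j3 := (i3.const_mul 2).const_mul (ε ^ 3)
    have j4 := i4.const_mul (ε ^ 4)
    have k1 : Integrable fun x => u.s x ^ 2 + ε * (2 * (u.s x * v x)) := hi.add j1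
    have k2 : Integrable fun x => u.s x ^ 2 + ε * (2 * (u.s x * v x))
        + ε ^ 2 * (v x * v x + 2 * (u.s x * η.s x)) := k1.add j2
    have k3 : Integrable fun x => u.s x ^ 2 + ε * (2 * (u.s x * v x))
        + ε ^ 2 * (v x * v x + 2 * (u.s x * η.s x)) + ε ^ 3 * (2 * (v x * η.s x)) := k2.add j3
    rw [Hc, e, integral_add k3 j4, integral_add k2 j3, integral_add k1 j2, integral_add hi j1]
    simp only [integral_const_mul]
  have hG : (kerElem u 0 u.s).pairing η = -∫ x, u.s x * v x := by
    rw [Fields.pairing, ← integral_neg, kerElem_zero]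
    congr 1
    funext x
    simp [Fin.sum_univ_four, v]
    ring
  rw [hH, hG]
  generalize (∫ x, u.s x * v x) = c1
  generalize (∫ x, u.s x ^ 2) = c0
  generalize (∫ x, v x * v x + 2 * (u.s x * η.s x)) = c2
  generalize (∫ x, v x * η.s x) = c3
  generalize (∫ x, η.s x * η.s x) = c4
  have h1 := hasDerivAt_id (0 : ℝ)
  have hp : ∀ n : ℕ, HasDerivAt (fun ε : ℝ => ε ^ n) (n * 0 ^ (n - 1)) 0 := fun n =>
    hasDerivAt_pow n 0
  refine HasDerivAt.congr_deriv ((((((hasDerivAt_const 0 c0).add (h1.mul_const (2 * c1))).add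
    ((hp 2).mul_const c2)).add ((hp 3).mul_const (2 * c3))).add
    ((hp 4).mul_const c4)).const_mul (-(1 / 2) : ℝ)) ?_
  norm_num
  ring

theorem hasVariationalDeriv_Hc_iff {u G : Fields} (hu : InDomHc u) (hG : G.Smooth) :
    HasVariationalDeriv Hc u G ↔ G = kerElem u 0 u.s := by
  refine ⟨fun h => ?_, fun h => h ▸ hasVariationalDeriv_Hc hu⟩
  exact Fields.eq_of_pairing_eq hG (smooth_kerElem_zero hu.1 (smooth_s hu.1))
    fun η hη hηc => (h η hη hηc).unique (hasVariationalDeriv_Hc hu η hη hηc)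

/-! ### The constant-coefficient operator K and its flow. -/

theorem isHamiltonianOp_opK : IsHamiltonianOp fun _ => opK := by
  intro u _
  refine ⟨fun φ ψ hφ hφc hψ hψc => ?_, fun φ₁ φ₂ φ₃ _ _ _ _ _ _ => ?_⟩
  · have cφ := fun i => (hφ i).continuous
    have cψ := fun i => (hψ i).continuous
    have dφ := fun i x => hasDerivAt_deriv_of_smooth (hφ i) x
    have dψ := fun i x => hasDerivAt_deriv_of_smooth (hψ i) x
    have hcont : ∀ θ : Fields, θ.Smooth → ∀ i, Continuous (opK θ i) := by
      intro θ hθ i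
      have c := fun i => (hθ i).continuous
      have c' := fun i => (smooth_deriv (hθ i)).continuous
      fin_cases i
      · exact (c 1).neg.add (c' 2)
      · exact (c 0).add (c' 3)
      · exact (c' 0).add (c 3)
      · exact (c' 1).sub (c 2)
    have hint : ∀ φ ψ : Fields, φ.Smooth → φ.CompactSupp → ψ.Smooth →
        Integrable fun x => ∑ i, φ i x * opK ψ i x := fun φ ψ h1 h2 h3 =>
      integrable_finsetSum _ fun i _ =>
        (((h1 i).continuous.mul (hcont ψ h3 i)).integrable_of_hasCompactSupport (h2 i).mul_right)
    have e1 := hint φ ψ hφ hφc hψ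
    have e2 := hint ψ φ hψ hψc hφ
    rw [eq_neg_iff_add_eq_zero, Fields.pairing, Fields.pairing, ← integral_add e1 e2]
    -- In φ·Kψ + ψ·Kφ the zeroth-order terms cancel, and the rest is the total derivative of f.
    refine integral_eq_zero_of_hasDerivAt_of_integrable
      (f := fun x => φ 0 x * ψ 2 x + φ 1 x * ψ 3 x + φ 2 x * ψ 0 x + φ 3 x * ψ 1 x)
      (fun x => ?_) (e1.add e2) ?_
    · refine HasDerivAt.congr_deriv (((((dφ 0 x).mul (dψ 2 x)).add ((dφ 1 x).mul (dψ 3 x))).add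
        ((dφ 2 x).mul (dψ 0 x))).add ((dφ 3 x).mul (dψ 1 x))) ?_
      simp only [Fin.sum_univ_four, opK, Matrix.cons_val]
      ring
    · have hi : ∀ i j, Integrable fun x => φ i x * ψ j x := fun i j =>
        integrable_mul_of_compactSupp (cφ i) (cψ j) (hψc j)
      exact (((hi 0 2).add (hi 1 3)).add (hi 2 0)).add (hi 3 1)
  -- K does not depend on u, so each term of the Jacobi identity vanishes.
  · have h0 : ∀ w φ : Fields, dirDeriv (fun _ => opK) u w φ = 0 := fun w φ => by
      funext i x
      simp [dirDeriv]
    simp [h0, Fields.pairing]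

theorem solvesPositiveFlow_iff (T : Set ℝ) (u : ℝ → Fields) (hu : ∀ t ∈ T, InDomHc (u t)) :
    SolvesPositiveFlow T (fun t => (u t).s) u ↔
      SolvesHamiltonianSystem (fun _ => opK) Hc T u := by
  have hK : ∀ t x, opK (kerElem (u t) 0 (u t).s) 0 x
        = (u t).s x * u t 3 x - deriv (fun y => (u t).s y * u t 0 y) x ∧
      opK (kerElem (u t) 0 (u t).s) 1 x
        = -((u t).s x * u t 2 x) - deriv (fun y => (u t).s y * u t 1 y) x ∧
      opK (kerElem (u t) 0 (u t).s) 2 x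
        = -((u t).s x * u t 1 x) - deriv (fun y => (u t).s y * u t 2 y) x ∧
      opK (kerElem (u t) 0 (u t).s) 3 x
        = (u t).s x * u t 0 x - deriv (fun y => (u t).s y * u t 3 y) x := fun t x => by
    rw [kerElem_zero]
    refine ⟨?_, ?_, ?_, ?_⟩ <;> simp [opK, deriv.fun_neg] <;> ring
  constructor
  · intro h
    refine ⟨fun t => kerElem (u t) 0 (u t).s, fun t ht =>
      ⟨smooth_kerElem_zero (hu t ht).1 (smooth_s (hu t ht).1),
        hasVariationalDeriv_Hc (hu t ht), fun i x => ?_⟩⟩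
    obtain ⟨hd, e0, e1, e2, e3⟩ := h t ht x
    dsimp only at e0 e1 e2 e3
    obtain ⟨k0, k1, k2, k3⟩ := hK t x
    refine (hd i).hasDerivAt.congr_deriv ?_
    fin_cases i
    · exact (by linear_combination e0 : deriv (fun τ => u τ 0 x) t = _).trans k0.symm
    · exact (by linear_combination e1 : deriv (fun τ => u τ 1 x) t = _).trans k1.symm
    · exact (by linear_combination e2 : deriv (fun τ => u τ 2 x) t = _).trans k2.symm
    · exact (by linear_combination e3 : deriv (fun τ => u τ 3 x) t = _).trans k3.symm
  · rintro ⟨G, hG⟩ t ht x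
    obtain ⟨hs, hv, hd⟩ := hG t ht
    -- Uniqueness of the smooth gradient replaces the unspecified G by the explicit one.
    rw [(hasVariationalDeriv_Hc_iff (hu t ht) hs).1 hv] at hd
    obtain ⟨k0, k1, k2, k3⟩ := hK t x
    refine ⟨fun i => (hd i x).differentiableAt, ?_, ?_, ?_, ?_⟩
    · rw [(hd 0 x).deriv.trans k0]
      ring
    · rw [(hd 1 x).deriv.trans k1]
      ring
    · rw [(hd 2 x).deriv.trans k2]
      ring
    · rw [(hd 3 x).deriv.trans k3]
      ring

theorem mainTheorem4 :
    -- the kernel of `L`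
    (∀ u : Fields, u.Smooth → (∀ x, u 0 x ≠ 0) → (∀ x, u 1 x ≠ 0) → (∀ x, u.s x ≠ 0) →
      (∀ θ : Fields, InKerL u θ ↔
        ∃ (k : ℝ) (Γ : ℝ → ℝ), ContDiff ℝ ∞ Γ ∧ θ = kerElem u k Γ) ∧
      (∀ (k : ℝ) (Γ : ℝ → ℝ), ContDiff ℝ ∞ Γ → combK u (kerElem u k Γ) = formK u k)) ∧
    -- `L` is degenerate
    (∀ u : Fields, u.Smooth → u ≠ 0 → IsDegenerateL u) ∧
    -- `H_c` is a Casimir of `L`: its variational derivative is the kernel element with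
    -- `k = 0` and `Γ = m₁ n₁ + m₂ n₂`
    (∀ u : Fields, InDomHc u →
      (∀ G : Fields, G.Smooth → (HasVariationalDeriv Hc u G ↔ G = kerElem u 0 u.s)) ∧
      (kerElem u 0 u.s).Smooth ∧ InKerL u (kerElem u 0 u.s)) ∧
    -- `K` is a Hamiltonian operator, and the flow with `Γ = m₁ n₁ + m₂ n₂` is the Hamiltonian
    -- system of `K` with Hamiltonian `H_c`
    IsHamiltonianOp (fun _ => opK) ∧
    (∀ (T : Set ℝ) (u : ℝ → Fields), IsOpen T → (∀ t ∈ T, InDomHc (u t)) →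
      (SolvesPositiveFlow T (fun t => (u t).s) u ↔
        SolvesHamiltonianSystem (fun _ => opK) Hc T u)) := by
  refine ⟨fun u hu h0 h1 hs => ⟨fun θ => ⟨fun h => ?_, ?_⟩,
      fun k Γ _ => combK_kerElem hu h0 h1 hs k Γ⟩,
    fun u hu h => isDegenerateL hu h,
    fun u hu => ⟨fun G hG => hasVariationalDeriv_Hc_iff hu hG,
      smooth_kerElem_zero hu.1 (smooth_s hu.1), inKerL_kerElem_zero hu.1 (smooth_s hu.1)⟩,
    isHamiltonianOp_opK, fun T u _ hu => solvesPositiveFlow_iff T u hu⟩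
  · obtain ⟨hθ, a, b, c, d, q, r, hp⟩ := (inKerL_iff hu θ).1 h
    exact hp.exists_kerElem hu hθ h0 h1 hs
  · rintro ⟨k, Γ, hΓ, rfl⟩
    exact (inKerL_iff hu _).2 ⟨smooth_kerElem hu h0 h1 hs k hΓ,
      exists_kerPotentials hu hs (combK_kerElem hu h0 h1 hs k Γ)⟩
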